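/- Let $m, n \ge 0$ be integers. Let $G_{m,n}$ be the group with generators $s, t_1, \dots, t_m, u_1, \dots, u_n$ and defining relations $$[s, t_1, \dots, t_m],\qquad [s, u_1, \dots, u_n],\qquad [t_i, u_j]\quad (1 \le i \le m,\ 1 \le j \le n),$$ where $[x_1, x_2, \dots, x_k]$ denotes the cyclic relations $$x_1 x_2 \cdots x_k = x_2 \cdots x_k x_1 = \cdots = x_k x_1 \cdots x_{k-1}$$ (so $[t_i,u_j]$ is the relation $t_i u_j = u_j t_i$, and $[x_1]$ is an empty condition). Let $G^+_{m,n}$ be the monoid given by the same generators and relations, i.e. the quotient of the free monoid on $\{s, t_1, \dots, t_m, u_1, \dots, u_n\}$ by the smallest congruence containing these relations. Then the localization homomorphism $\pi : G^+_{m,n} \to G_{m,n}$, the natural monoid homomorphism that sends each generator to the generator of the same name, is injective. -/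

import Mathlib

/-! Monoids and groups given by the same positive presentation `⟨L ∣ R⟩`, where the relations
`R` are pairs `(a, b)` of positive words, written as a binary relation on the free monoid. -/

/-- The group `G = ⟨L ∣ R⟩` defined by the relations `a = b`, for `(a, b)` in `R`, between
positive words regarded as elements of the free group. -/
abbrev PositivelyPresentedGroup {L : Type*} (R : FreeMonoid L → FreeMonoid L → Prop) : Type _ :=
  PresentedGroup {w : FreeGroup L | ∃ a b : FreeMonoid L, R a b ∧
    w = FreeMonoid.lift FreeGroup.of a * (FreeMonoid.lift FreeGroup.of b)⁻¹}

/-- The relations of the presentation hold in the presented group. -/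
theorem positivelyPresentedGroup_rel {L : Type*} (R : FreeMonoid L → FreeMonoid L → Prop)
    (a b : FreeMonoid L) (h : R a b) :
    FreeMonoid.lift (fun x : L => (PresentedGroup.of x : PositivelyPresentedGroup R)) a =
      FreeMonoid.lift (fun x : L => (PresentedGroup.of x : PositivelyPresentedGroup R)) b := by
  have key : ∀ c : FreeMonoid L,
      FreeMonoid.lift (fun x : L => (PresentedGroup.of x : PositivelyPresentedGroup R)) c =
        PresentedGroup.mk _ (FreeMonoid.lift FreeGroup.of c) := by
    intro c
    induction c with
    | one => simp
    | of x => simp [PresentedGroup.of]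
    | mul x y hx hy => simp only [map_mul, hx, hy]
  rw [key, key]
  refine mul_inv_eq_one.1 ?_
  rw [← map_inv, ← map_mul]
  exact (QuotientGroup.eq_one_iff _).2 (Subgroup.subset_normalClosure ⟨a, b, h, rfl⟩)

/-- The localization homomorphism `π : G⁺ → G`: the natural homomorphism from the monoid
`G⁺ = ⟨L ∣ R⟩_mo` to the group `G = ⟨L ∣ R⟩`, which sends each generator to the generator of the
same name. -/
def localizationHom {L : Type*} (R : FreeMonoid L → FreeMonoid L → Prop) :
    PresentedMonoid R →* PositivelyPresentedGroup R :=
  PresentedMonoid.lift (fun x : L => (PresentedGroup.of x : PositivelyPresentedGroup R))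
    (positivelyPresentedGroup_rel R)

/-- The alphabet `s, t₁, …, tₘ, u₁, …, uₙ`. -/
inductive Letter (m n : ℕ) : Type
  | s : Letter m n
  | t (i : Fin m) : Letter m n
  | u (j : Fin n) : Letter m n

/-- The defining relations: the cyclic relations `[s, t₁, …, tₘ]` and `[s, u₁, …, uₙ]`, each of
which says that the word in brackets equals all of its rotations
(`x₁x₂⋯xₖ = x₂⋯xₖx₁ = ⋯ = xₖx₁⋯xₖ₋₁`), and the commutation relations
`[tᵢ, uⱼ]`, that is `tᵢuⱼ = uⱼtᵢ`. -/
inductive ArrangementRel (m n : ℕ) : FreeMonoid (Letter m n) → FreeMonoid (Letter m n) → Prop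
  | cyclic_t (k : ℕ) : ArrangementRel m n
      (FreeMonoid.ofList (Letter.s :: List.ofFn Letter.t))
      (FreeMonoid.ofList ((Letter.s :: List.ofFn Letter.t).rotate k))
  | cyclic_u (k : ℕ) : ArrangementRel m n
      (FreeMonoid.ofList (Letter.s :: List.ofFn Letter.u))
      (FreeMonoid.ofList ((Letter.s :: List.ofFn Letter.u).rotate k))
  | comm (i : Fin m) (j : Fin n) : ArrangementRel m n
      (FreeMonoid.of (Letter.t i) * FreeMonoid.of (Letter.u j))
      (FreeMonoid.of (Letter.u j) * FreeMonoid.of (Letter.t i))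

/-- The monoid `G⁺_{m,n}`. -/
abbrev ArrangementMonoid (m n : ℕ) : Type := PresentedMonoid (ArrangementRel m n)

/-- The group `G_{m,n}`. -/
abbrev ArrangementGroup (m n : ℕ) : Type := PositivelyPresentedGroup (ArrangementRel m n)

/-!
The group is isomorphic to `F_m × F_n × ℤ`: conjugation by `s` is an inner automorphism on the free
groups on the `tᵢ` and on the `uⱼ`. Accordingly the monoid is a fibre product, over the number of
letters `s`, of two monoids with one cyclic relation each, and both halves of this statement are
proved directly on words.

*One cyclic relation.* In the monoid `⟨x₀, …, xₘ ∣ [x₀, …, xₘ]⟩` the full cycle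
`Δ = xᵢ xᵢ₊₁ ⋯ xᵢ₊ₘ` (indices modulo `m + 1`) does not depend on `i` and is central, so that every
element has the form `Δ ^ r * w` with a word `w` that contains no full cycle. Left multiplication by
a letter is described on such pairs `(r, w)` by `pushLetter`; the point is that a full cycle acts by
`(r, w) ↦ (r + 1, w)` (`foldr_pushLetter_fullCycle`). Once `r` ranges over `ℤ`, the letters hence act
by permutations that satisfy the cyclic relation, and the image of `(0, [])` is the normal form. So
a word is determined in the monoid by the permutation it induces
(`CycleRel.word_eq_of_prod_pushPerm_eq`). As the group acts on these pairs, with the other half of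
the alphabet acting trivially, words with the same image in the group have the same projections to
the two monoids with one cyclic relation (`word_tIndex_eq_of_localizationHom_eq`,
`word_uIndex_eq_of_localizationHom_eq`).

*Interleaving.* Since the `tᵢ` and the `uⱼ` commute, a word is determined in the monoid by its
projections `a` to `s, tᵢ` and `b` to `s, uⱼ`. For fixed `b`, its value depends only on the class of
`a` (`prod_map_eval_eq_of_word_tIndex_eq`): letting `b` vary, the letters of `a` act on functions of
`b` by operators that satisfy the cyclic relation. Given two words with the same image in the group,
these have the same number of letters `s`, so there is a word with the second projection of the one
and the first projection of the other, and it equals both.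
-/

/-! ### Cyclic runs of letters -/

section CyclicRuns

open scoped Fin.CommRing

/-- The word `i, i + 1, …, i + l - 1` of length `l` on the cyclic alphabet `Fin (m + 1)`. -/
def cyclicRun {m : ℕ} (i : Fin (m + 1)) : ℕ → List (Fin (m + 1))
  | 0 => []
  | l + 1 => i :: cyclicRun (i + 1) l

theorem cyclicRun_add {m : ℕ} (i : Fin (m + 1)) (k l : ℕ) :
    cyclicRun i (k + l) = cyclicRun i k ++ cyclicRun (i + (k : Fin (m + 1))) l := by
  induction k generalizing i with
  | zero => simp [cyclicRun]
  | succ k ih =>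
    rw [Nat.succ_add]
    simp only [cyclicRun, ih, List.cons_append, Nat.cast_succ]
    rw [add_assoc i 1, add_comm 1 (k : Fin (m + 1))]

theorem length_cyclicRun {m : ℕ} (i : Fin (m + 1)) (l : ℕ) : (cyclicRun i l).length = l := by
  induction l generalizing i with
  | zero => rfl
  | succ l ih => simp [cyclicRun, ih]

theorem cyclicRun_eq_map_range {m : ℕ} (i : Fin (m + 1)) (l : ℕ) :
    cyclicRun i l = (List.range l).map fun k : ℕ => i + (k : Fin (m + 1)) := by
  induction l with
  | zero => rfl
  | succ l ih => rw [cyclicRun_add, ih, List.range_succ]; simp [cyclicRun]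

theorem cyclicRun_succ_full {m : ℕ} (i : Fin (m + 1)) :
    cyclicRun (i + 1) (m + 1) = cyclicRun (i + 1) m ++ [i] := by
  rw [cyclicRun_add, add_assoc, add_comm 1 (m : Fin (m + 1)), ← Nat.cast_succ,
    Fin.natCast_self, add_zero]
  rfl

theorem finRange_rotate {m : ℕ} (k : ℕ) :
    (List.finRange (m + 1)).rotate k = cyclicRun (k : Fin (m + 1)) (m + 1) := by
  induction k with
  | zero =>
    rw [List.rotate_zero, cyclicRun_eq_map_range]
    apply List.ext_getElem
    · simp
    · intro j h₁ h₂
      have hj : j < m + 1 := by simpa using h₁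
      ext
      simp [Fin.val_natCast, Nat.mod_eq_of_lt hj]
  | succ k ih =>
    rw [← List.rotate_rotate, ih, Nat.cast_succ, cyclicRun_succ_full]
    simp [cyclicRun]

/-! ### The action on reduced words -/

/-- Left multiplication by the letter `i` on pairs `(r, w)`, which stand for `Δ ^ r * w`. If `i`
completes a full cycle at the beginning of `w`, that cycle is removed and counted in `r`. -/
def pushLetter {m : ℕ} (i : Fin (m + 1)) (p : ℤ × List (Fin (m + 1))) :
    ℤ × List (Fin (m + 1)) :=
  if cyclicRun (i + 1) m <+: p.2 then (p.1 + 1, p.2.drop m) else (p.1, i :: p.2)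

theorem pushLetter_cyclicRun_append {m : ℕ} (i : Fin (m + 1)) (r : ℤ) (w : List (Fin (m + 1))) :
    pushLetter i (r, cyclicRun (i + 1) m ++ w) = (r + 1, w) := by
  rw [pushLetter, if_pos (List.prefix_append _ _)]
  simp [List.drop_left' (length_cyclicRun _ _)]

/-- A run pushed onto a shorter run that it continues merges with it, without completing a cycle,
as long as the total length is at most `m` and the next letter does not continue the run. -/
theorem foldr_pushLetter_cyclicRun {m : ℕ} (k l : ℕ) (hkl : k + l ≤ m) (i : Fin (m + 1)) (r : ℤ)
    (w : List (Fin (m + 1))) (hw : ¬ [i + ((k + l : ℕ) : Fin (m + 1))] <+: w) :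
    (cyclicRun i k).foldr pushLetter (r, cyclicRun (i + (k : Fin (m + 1))) l ++ w) =
      (r, cyclicRun i (k + l) ++ w) := by
  induction k generalizing i with
  | zero => simp [cyclicRun]
  | succ k ih =>
    have e : ∀ j : ℕ, i + 1 + (j : Fin (m + 1)) = i + ((j + 1 : ℕ) : Fin (m + 1)) := by
      intro j; push_cast; ring
    have h := ih (by omega) (i + 1) (by rw [e]; convert hw using 5; omega)
    rw [e] at h
    rw [show k + 1 + l = (k + l) + 1 by omega]
    simp only [cyclicRun, List.foldr_cons, List.cons_append]
    rw [h, pushLetter, if_neg]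
    intro hp
    apply hw
    obtain ⟨d, hd⟩ : ∃ d, m = (k + l) + (d + 1) := ⟨m - (k + l) - 1, by omega⟩
    have hr : cyclicRun (i + 1) m = cyclicRun (i + 1) (k + l) ++
        cyclicRun (i + 1 + ((k + l : ℕ) : Fin (m + 1))) (d + 1) := by
      rw [← cyclicRun_add, ← hd]
    rw [hr] at hp
    have hp' := (List.prefix_append_right_inj _).1 hp
    rw [cyclicRun, e, show k + l + 1 = k + 1 + l by omega] at hp'
    exact (List.prefix_append [_] _).trans hp'

theorem exists_maximal_cyclicRun {m : ℕ} (i : Fin (m + 1)) (w : List (Fin (m + 1))) (n : ℕ)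
    (h : ¬ cyclicRun i n <+: w) :
    ∃ l < n, ∃ v, w = cyclicRun i l ++ v ∧ ¬ [i + (l : Fin (m + 1))] <+: v := by
  induction n with
  | zero => exact absurd (List.nil_prefix) h
  | succ n ih =>
    by_cases hn : cyclicRun i n <+: w
    · obtain ⟨v, rfl⟩ := hn
      refine ⟨n, n.lt_succ_self, v, rfl, fun hv => h ?_⟩
      rw [cyclicRun_add]
      exact (List.prefix_append_right_inj _).2 hv
    · obtain ⟨l, hl, v, hv⟩ := ih hn
      exact ⟨l, hl.trans n.lt_succ_self, v, hv⟩

/-- Pushing a full cycle onto a word which does not begin with that cycle only increases the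
counter. If `i, …, i + l - 1` is the longest run from `i` at the beginning of the word, the last
`m - l` letters of the cycle extend this run to length `m`, the next letter completes it, and the
remaining letters restore what has been removed. -/
theorem foldr_pushLetter_fullCycle {m : ℕ} (i : Fin (m + 1)) (r : ℤ) (w : List (Fin (m + 1)))
    (h : ¬ cyclicRun i (m + 1) <+: w) :
    (cyclicRun i (m + 1)).foldr pushLetter (r, w) = (r + 1, w) := by
  obtain ⟨l, hl, v, rfl, hv⟩ := exists_maximal_cyclicRun i w (m + 1) h
  obtain ⟨d, hd⟩ : ∃ d, m = d + l := ⟨m - l, by omega⟩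
  have hsplit : cyclicRun i (m + 1) = cyclicRun i l ++
      (i + (l : Fin (m + 1))) :: cyclicRun (i + (l : Fin (m + 1)) + 1) d := by
    rw [show cyclicRun i (m + 1) = cyclicRun i (l + (d + 1)) by congr 1; omega, cyclicRun_add,
      cyclicRun]
  have hm : ((m + 1 : ℕ) : Fin (m + 1)) = 0 := Fin.natCast_self _
  have hback : i + (l : Fin (m + 1)) + 1 + (d : Fin (m + 1)) = i := by
    have h0 : (l : Fin (m + 1)) + 1 + (d : Fin (m + 1)) = ((m + 1 : ℕ) : Fin (m + 1)) := by
      rw [show ((m + 1 : ℕ) : Fin (m + 1)) = ((l + 1 + d : ℕ) : Fin (m + 1)) by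
        congr 1; omega]
      push_cast; rfl
    rw [add_assoc i, add_assoc i, h0, hm, add_zero]
  have hext := foldr_pushLetter_cyclicRun d l hd.ge (i + (l : Fin (m + 1)) + 1) r v (by
    rw [Nat.cast_add, ← add_assoc, hback]; exact hv)
  rw [hback, show cyclicRun (i + (l : Fin (m + 1)) + 1) (d + l) =
    cyclicRun (i + (l : Fin (m + 1)) + 1) m by congr 1; exact hd.symm] at hext
  have hrestore := foldr_pushLetter_cyclicRun l 0 (by omega) i (r + 1) v hv
  rw [hsplit, List.foldr_append, List.foldr_cons, hext, pushLetter_cyclicRun_append]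
  exact hrestore

end CyclicRuns

/-- Pairs `(r, w)` where the word `w` contains no full cycle. The exponent `r` of `Δ` is an integer,
so that `Δ`, which only occurs to non-negative powers in the monoid, acts bijectively. -/
abbrev ReducedPair (m : ℕ) : Type :=
  {p : ℤ × List (Fin (m + 1)) // ∀ i, ¬ cyclicRun i (m + 1) <:+: p.2}

theorem pushLetter_reduced {m : ℕ} (i : Fin (m + 1)) {p : ℤ × List (Fin (m + 1))}
    (hp : ∀ j, ¬ cyclicRun j (m + 1) <:+: p.2) (j : Fin (m + 1)) :
    ¬ cyclicRun j (m + 1) <:+: (pushLetter i p).2 := by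
  rw [pushLetter]
  split_ifs with h
  · exact fun hj => hp j (hj.trans (List.drop_suffix _ _).isInfix)
  · rw [List.infix_cons_iff]
    rintro (hj | hj)
    · rw [cyclicRun, List.cons_prefix_cons] at hj
      exact h (hj.1 ▸ hj.2)
    · exact hp j hj

/-- `pushLetter` restricted to pairs with a reduced word. -/
def ReducedPair.push {m : ℕ} (i : Fin (m + 1)) (p : ReducedPair m) : ReducedPair m :=
  ⟨pushLetter i p.1, pushLetter_reduced i p.2⟩

theorem ReducedPair.val_foldr_push {m : ℕ} (l : List (Fin (m + 1))) (p : ReducedPair m) :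
    (l.foldr ReducedPair.push p).1 = l.foldr pushLetter p.1 := by
  induction l with
  | nil => rfl
  | cons i l ih => simp only [List.foldr_cons, ← ih]; rfl

theorem ReducedPair.val_foldr_push_fullCycle {m : ℕ} (i : Fin (m + 1)) (p : ReducedPair m) :
    ((cyclicRun i (m + 1)).foldr ReducedPair.push p).1 = (p.1.1 + 1, p.1.2) := by
  rw [val_foldr_push]
  exact foldr_pushLetter_fullCycle i p.1.1 p.1.2 fun h => p.2 i h.isInfix

/-- A letter is both the first and the last factor of a full cycle, and full cycles act
bijectively. -/
theorem ReducedPair.push_bijective {m : ℕ} (i : Fin (m + 1)) :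
    Function.Bijective (ReducedPair.push i) := by
  constructor
  · intro p q hpq
    have h : (cyclicRun (i + 1) (m + 1)).foldr push p =
        (cyclicRun (i + 1) (m + 1)).foldr push q := by
      simp only [cyclicRun_succ_full, List.foldr_append, List.foldr_cons, List.foldr_nil, hpq]
    have h' := congrArg Subtype.val h
    rw [val_foldr_push_fullCycle, val_foldr_push_fullCycle, Prod.mk.injEq] at h'
    exact Subtype.ext (Prod.ext (add_right_cancel h'.1) h'.2)
  · rintro ⟨⟨r, w⟩, hw⟩
    refine ⟨(cyclicRun (i + 1) m).foldr push ⟨(r - 1, w), hw⟩, Subtype.ext ?_⟩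
    have h := val_foldr_push_fullCycle i ⟨(r - 1, w), hw⟩
    rw [cyclicRun, List.foldr_cons] at h
    simpa using h

/-- The permutation of reduced pairs given by a letter. -/
noncomputable def pushPerm {m : ℕ} (i : Fin (m + 1)) : Equiv.Perm (ReducedPair m) :=
  Equiv.ofBijective _ (ReducedPair.push_bijective i)

theorem prod_map_pushPerm_apply {m : ℕ} (l : List (Fin (m + 1))) (p : ReducedPair m) :
    (l.map pushPerm).prod p = l.foldr ReducedPair.push p := by
  induction l with
  | nil => rfl
  | cons i l ih =>
    rw [List.map_cons, List.prod_cons, Equiv.Perm.mul_apply, ih]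
    rfl

/-! ### The monoid of a single cyclic relation -/

/-- The product of `l` equals the products of all rotations of `l`: the relation `[x₁, …, xₖ]`. -/
def RotationInvariant {M : Type*} [Monoid M] (l : List M) : Prop :=
  ∀ k, (l.rotate k).prod = l.prod

theorem rotationInvariant_pushPerm (m : ℕ) :
    RotationInvariant ((List.finRange (m + 1)).map (pushPerm (m := m))) := by
  have key : ∀ k, (((List.finRange (m + 1)).map (pushPerm (m := m))).rotate k).prod =
      (((List.finRange (m + 1)).map (pushPerm (m := m))).rotate 0).prod := by
    intro k
    refine Equiv.ext fun p => Subtype.ext ?_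
    rw [← List.map_rotate, ← List.map_rotate, finRange_rotate, finRange_rotate,
      prod_map_pushPerm_apply, prod_map_pushPerm_apply, ReducedPair.val_foldr_push_fullCycle,
      ReducedPair.val_foldr_push_fullCycle]
  intro k
  rw [key, List.rotate_zero]

/-- The cyclic relations `[x₀, …, xₘ]` on the alphabet `Fin (m + 1)`. -/
inductive CycleRel (m : ℕ) : FreeMonoid (Fin (m + 1)) → FreeMonoid (Fin (m + 1)) → Prop
  | rotate (k : ℕ) : CycleRel m (FreeMonoid.ofList (List.finRange (m + 1)))
      (FreeMonoid.ofList ((List.finRange (m + 1)).rotate k))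

namespace CycleRel

variable {m : ℕ}

/-- The class of a word in the monoid with the single cyclic relation `[x₀, …, xₘ]`. -/
def word (l : List (Fin (m + 1))) : PresentedMonoid (CycleRel m) :=
  PresentedMonoid.mk _ (FreeMonoid.ofList l)

theorem word_append (l l' : List (Fin (m + 1))) : word (l ++ l') = word l * word l' := rfl

theorem word_cons (i : Fin (m + 1)) (l : List (Fin (m + 1))) :
    word (i :: l) = word [i] * word l := rfl

theorem word_fullCycle (i : Fin (m + 1)) :
    word (cyclicRun i (m + 1)) = word (cyclicRun (0 : Fin (m + 1)) (m + 1)) := by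
  have h : ∀ k, word ((List.finRange (m + 1)).rotate k) = word (List.finRange (m + 1)) :=
    fun k => (PresentedMonoid.mk_eq_mk_of_rel (CycleRel.rotate k)).symm
  have hi := (h i.val).trans (h 0).symm
  rw [finRange_rotate, finRange_rotate] at hi
  simpa using hi

/-- The full cycle is central. -/
theorem commute_fullCycle (i : Fin (m + 1)) :
    Commute (word [i]) (word (cyclicRun (0 : Fin (m + 1)) (m + 1))) := by
  calc word [i] * word (cyclicRun (0 : Fin (m + 1)) (m + 1))
      = word [i] * word (cyclicRun (i + 1) (m + 1)) := by rw [word_fullCycle (i + 1)]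
    _ = word (cyclicRun i (m + 1)) * word [i] := by
        rw [cyclicRun_succ_full, cyclicRun, word_append, word_cons i (cyclicRun _ _), mul_assoc]
    _ = _ := by rw [word_fullCycle i]

/-- The action on the pair `(0, [])` computes a normal form `Δ ^ r * w`, where `Δ` is the class of
the full cycle. -/
theorem exists_word_eq_pow_mul (l : List (Fin (m + 1))) :
    ∃ (r : ℕ) (w : List (Fin (m + 1))), l.foldr pushLetter (0, []) = ((r : ℤ), w) ∧
      word l = word (cyclicRun (0 : Fin (m + 1)) (m + 1)) ^ r * word w := by
  induction l with
  | nil => exact ⟨0, [], rfl, by rw [pow_zero, one_mul]⟩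
  | cons i l ih =>
    obtain ⟨r, w, h, hw⟩ := ih
    rw [List.foldr_cons, h, word_cons, hw, ← mul_assoc, ((commute_fullCycle i).pow_right r).eq]
    by_cases hp : cyclicRun (i + 1) m <+: w
    · obtain ⟨v, rfl⟩ := hp
      refine ⟨r + 1, v, by rw [pushLetter_cyclicRun_append]; simp, ?_⟩
      rw [word_append, mul_assoc, ← mul_assoc (word [i]), ← word_cons,
        show i :: cyclicRun (i + 1) m = cyclicRun i (m + 1) from rfl, word_fullCycle i, pow_succ,
        mul_assoc]
    · exact ⟨r, i :: w, by rw [pushLetter, if_neg hp], by rw [word_cons i w, mul_assoc]⟩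

/-- Words that act in the same way on reduced pairs are equal in the monoid. -/
theorem word_eq_of_prod_pushPerm_eq {l l' : List (Fin (m + 1))}
    (h : (l.map pushPerm).prod = (l'.map pushPerm).prod) : word l = word l' := by
  have h₁ : ∀ i : Fin (m + 1), ¬ cyclicRun i (m + 1) <:+: [] := fun i hi => by
    simp [cyclicRun] at hi
  have h₂ := congrArg (fun f => (f (⟨(0, []), h₁⟩ : ReducedPair m)).1) h
  beta_reduce at h₂
  rw [prod_map_pushPerm_apply, prod_map_pushPerm_apply, ReducedPair.val_foldr_push,
    ReducedPair.val_foldr_push] at h₂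
  obtain ⟨r, w, hr, hw⟩ := exists_word_eq_pow_mul l
  obtain ⟨r', w', hr', hw'⟩ := exists_word_eq_pow_mul l'
  rw [hr, hr', Prod.mk.injEq, Nat.cast_inj] at h₂
  rw [hw, hw', h₂.1, h₂.2]

end CycleRel

/-! ### Interleaving words in the two halves of the alphabet -/

namespace Letter

variable {m n : ℕ}

/-- The map on letters with prescribed values on `s`, the `tᵢ` and the `uⱼ`. -/
def eval {M : Type*} (s : M) (t : Fin m → M) (u : Fin n → M) : Letter m n → M
  | .s => s
  | .t i => t i
  | .u j => u j

/-- The position of a letter in the cycle `s, t₁, …, tₘ`. -/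
def tIndex : Letter m n → Option (Fin (m + 1))
  | .s => some 0
  | .t i => some i.succ
  | .u _ => none

/-- The position of a letter in the cycle `s, u₁, …, uₙ`. -/
def uIndex : Letter m n → Option (Fin (n + 1))
  | .s => some 0
  | .t _ => none
  | .u j => some j.succ

@[simp]
theorem filterMap_tIndex_u_cons (j : Fin n) (w : List (Letter m n)) :
    (u j :: w).filterMap tIndex = w.filterMap tIndex := List.filterMap_cons_none rfl

@[simp]
theorem filterMap_uIndex_t_cons (i : Fin m) (w : List (Letter m n)) :
    (t i :: w).filterMap uIndex = w.filterMap uIndex := List.filterMap_cons_none rfl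

/-- The exchange of the letters `tᵢ` and `uᵢ`. -/
def swap : Letter m n → Letter n m
  | .s => .s
  | .t i => .u i
  | .u j => .t j

theorem filterMap_tIndex_map_swap (w : List (Letter m n)) :
    (w.map swap).filterMap tIndex = w.filterMap uIndex := by
  rw [List.filterMap_map]
  congr 1
  funext x
  cases x <;> rfl

theorem filterMap_uIndex_map_swap (w : List (Letter m n)) :
    (w.map swap).filterMap uIndex = w.filterMap tIndex := by
  rw [List.filterMap_map]
  congr 1
  funext x
  cases x <;> rfl

theorem map_eval_map_swap {M : Type*} (s : M) (t : Fin m → M) (u : Fin n → M)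
    (w : List (Letter m n)) : (w.map swap).map (eval s u t) = w.map (eval s t u) := by
  rw [List.map_map]
  congr 1
  funext x
  cases x <;> rfl

theorem prod_map_eval_one {M : Type*} [Monoid M] (g : Fin (m + 1) → M) (w : List (Letter m n)) :
    (w.map (eval (g 0) (fun i => g i.succ) fun _ => 1)).prod =
      ((w.filterMap tIndex).map g).prod := by
  induction w with
  | nil => rfl
  | cons x w ih => cases x <;> simp [eval, tIndex, ih]

/-- Words in `s, tᵢ` and in `s, uⱼ` with the same number of letters `s` have an interleaving. -/
theorem exists_filterMap_eq (a : List (Fin (m + 1))) (b : List (Fin (n + 1)))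
    (h : a.count 0 = b.count 0) :
    ∃ w : List (Letter m n), w.filterMap tIndex = a ∧ w.filterMap uIndex = b := by
  induction a generalizing b with
  | nil =>
    induction b with
    | nil => exact ⟨[], rfl, rfl⟩
    | cons y b ih =>
      cases y using Fin.cases with
      | zero => simp at h
      | succ j =>
        obtain ⟨w, h₁, h₂⟩ := ih (by simpa [List.count_cons] using h)
        exact ⟨.u j :: w, by simpa using h₁, by simp [uIndex, h₂]⟩
  | cons x a ih =>
    cases x using Fin.cases with
    | succ i =>
      obtain ⟨w, h₁, h₂⟩ := ih b (by simpa [List.count_cons] using h)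
      exact ⟨.t i :: w, by simp [tIndex, h₁], by simpa using h₂⟩
    | zero =>
      induction b with
      | nil => simp at h
      | cons y b ihb =>
        cases y using Fin.cases with
        | zero =>
          obtain ⟨w, h₁, h₂⟩ := ih b (by simpa using h)
          exact ⟨.s :: w, by simp [tIndex, h₁], by simp [uIndex, h₂]⟩
        | succ j =>
          obtain ⟨w, h₁, h₂⟩ := ihb (by simpa [List.count_cons] using h)
          exact ⟨.u j :: w, by simpa using h₁, by simp [uIndex, h₂]⟩

end Letter

theorem List.exists_rotate_cons_eq {α : Type*} (a : α) (l : List α) (k : ℕ) :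
    ∃ c d, l = d ++ c ∧ (a :: l).rotate k = c ++ a :: d := by
  induction k with
  | zero => exact ⟨[], l, by simp, by simp⟩
  | succ k ih =>
    obtain ⟨c, d, rfl, h⟩ := ih
    rw [← List.rotate_rotate, h]
    cases c with
    | nil => exact ⟨d, [], by simp, by simp⟩
    | cons x c => exact ⟨c, d ++ [x], by simp, by simp⟩

section Interleaving

variable {M : Type*} [Monoid M] {m n : ℕ} (s : M) (t : Fin m → M) (u : Fin n → M)

/-- The operator by which `s` acts on functions `f` of words in `s, uⱼ`: all letters up to and
including the first `s` are emitted, and `f` receives the rest. If there is no letter `s`, one is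
assumed at the end, so that the cyclic relations hold for these operators on all words. -/
def emitThroughS (f : List (Fin (n + 1)) → M) : List (Fin (n + 1)) → M
  | [] => s * f []
  | x :: b => Fin.cases (s * f b) (fun j => u j * emitThroughS f b) x

/-- The operators by which the letters `s, tᵢ` act on functions of words in `s, uⱼ`. -/
def interleaveLetter : Fin (m + 1) → Function.End (List (Fin (n + 1)) → M) :=
  Fin.cases (fun f => emitThroughS s u f) fun i f b => t i * f b

/-- The value of a word in the `uⱼ`; letters `s` are ignored. -/
def uValue (b : List (Fin (n + 1))) : M := (b.map (Fin.cases 1 u)).prod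

variable {s t u}

/-- An identity `c * s * d = c' * s * d'` persists when letters `uⱼ` that commute with `c` and `c'`
are emitted in front of `s`. -/
theorem mul_emitThroughS_congr {c d c' d' : M} (hc : ∀ j, Commute (u j) c)
    (hc' : ∀ j, Commute (u j) c') (h : c * s * d = c' * s * d')
    (f : List (Fin (n + 1)) → M) (b : List (Fin (n + 1))) :
    c * emitThroughS s u (fun b => d * f b) b = c' * emitThroughS s u (fun b => d' * f b) b := by
  induction b with
  | nil => simp only [emitThroughS, ← mul_assoc, h]
  | cons y b ih =>
    cases y using Fin.cases with
    | zero => simp only [emitThroughS, Fin.cases_zero, ← mul_assoc, h]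
    | succ j =>
      simp only [emitThroughS, Fin.cases_succ]
      rw [← mul_assoc, ← (hc j).eq, mul_assoc, ih, ← mul_assoc, (hc' j).eq, mul_assoc]

theorem prod_map_interleaveLetter_succ (l : List (Fin m)) (f : List (Fin (n + 1)) → M) :
    ((l.map Fin.succ).map (interleaveLetter s t u)).prod f = fun b => (l.map t).prod * f b := by
  induction l with
  | nil => funext b; simp; rfl
  | cons i l ih =>
    funext b
    rw [List.map_cons, List.map_cons, List.prod_cons, List.map_cons, List.prod_cons, mul_assoc]
    exact congrArg (t i * ·) (congrFun ih b)

theorem rotationInvariant_interleaveLetter (ht : RotationInvariant (s :: List.ofFn t))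
    (hc : ∀ i j, Commute (t i) (u j)) :
    RotationInvariant ((List.finRange (m + 1)).map (interleaveLetter s t u)) := by
  have hs : s :: List.ofFn t =
      (0 :: (List.finRange m).map Fin.succ).map (Fin.cases s t : Fin (m + 1) → M) := by
    simp [List.ofFn_eq_map]
  have hcomm : ∀ (l : List (Fin m)) (j : Fin n), Commute (u j) (l.map t).prod := by
    intro l j
    refine Commute.list_prod_right _ _ fun x hx => ?_
    obtain ⟨i, -, rfl⟩ := List.mem_map.1 hx
    exact (hc i j).symm
  have key : ∀ (c d : List (Fin m)) (f : List (Fin (n + 1)) → M),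
      ((c.map Fin.succ ++ 0 :: d.map Fin.succ).map (interleaveLetter s t u)).prod f =
        fun b => (c.map t).prod * emitThroughS s u (fun b => (d.map t).prod * f b) b := by
    intro c d f
    rw [List.map_append, List.prod_append, List.map_cons, List.prod_cons,
      ← prod_map_interleaveLetter_succ (s := s) (t := t) (u := u) d f,
      ← prod_map_interleaveLetter_succ (s := s) (t := t) (u := u) c]
    rfl
  intro k
  have htk := ht k
  rw [hs, ← List.map_rotate] at htk
  rw [← List.map_rotate, List.finRange_succ]
  obtain ⟨c, d, hl, hr⟩ := List.exists_rotate_cons_eq 0 ((List.finRange m).map Fin.succ) k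
  obtain ⟨d, c, hl', rfl, rfl⟩ := List.map_eq_append_iff.1 hl
  rw [hr] at htk ⊢
  funext f
  rw [key]
  have key' := key [] (List.finRange m) f
  rw [List.map_nil, List.nil_append] at key'
  rw [key']
  funext b
  refine mul_emitThroughS_congr (hcomm c) (hcomm []) ?_ f b
  simpa [Function.comp_def, mul_assoc] using htk

theorem prod_map_interleaveLetter_uValue_cons (hc : ∀ i j, Commute (t i) (u j))
    (a : List (Fin (m + 1))) (j : Fin n) (b : List (Fin (n + 1))) :
    (a.map (interleaveLetter s t u)).prod (uValue u) (j.succ :: b) =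
      u j * (a.map (interleaveLetter s t u)).prod (uValue u) b := by
  induction a with
  | nil => exact List.prod_cons
  | cons x a ih =>
    rw [List.map_cons, List.prod_cons]
    cases x using Fin.cases with
    | zero => rfl
    | succ i =>
      change t i * _ = u j * (t i * _)
      rw [ih, ← mul_assoc, (hc i j).eq, mul_assoc]

/-- The value of a word can be computed from its two projections, and depends on the first of them
only through the action of its letters. -/
theorem prod_map_interleaveLetter_apply (hc : ∀ i j, Commute (t i) (u j))
    (w : List (Letter m n)) :
    ((w.filterMap Letter.tIndex).map (interleaveLetter s t u)).prod (uValue u)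
      (w.filterMap Letter.uIndex) = (w.map (Letter.eval s t u)).prod := by
  induction w with
  | nil => rfl
  | cons x w ih =>
    rw [List.map_cons, List.prod_cons, ← ih]
    cases x with
    | s => rfl
    | t i => rfl
    | u j => exact prod_map_interleaveLetter_uValue_cons hc _ j _

/-- For a fixed projection to `s, uⱼ`, the value of a word depends only on the class of its
projection to `s, tᵢ` in the monoid of the single cyclic relation. -/
theorem prod_map_eval_eq_of_word_tIndex_eq (ht : RotationInvariant (s :: List.ofFn t))
    (hc : ∀ i j, Commute (t i) (u j)) {w w' : List (Letter m n)}
    (h : CycleRel.word (w.filterMap Letter.tIndex) = CycleRel.word (w'.filterMap Letter.tIndex))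
    (h' : w.filterMap Letter.uIndex = w'.filterMap Letter.uIndex) :
    (w.map (Letter.eval s t u)).prod = (w'.map (Letter.eval s t u)).prod := by
  have hrel : ∀ a b, CycleRel m a b → FreeMonoid.lift (interleaveLetter s t u) a =
      FreeMonoid.lift (interleaveLetter s t u) b := by
    rintro _ _ ⟨k⟩
    rw [FreeMonoid.lift_apply, FreeMonoid.lift_apply]
    have := rotationInvariant_interleaveLetter ht hc k
    rw [← List.map_rotate] at this
    exact this.symm
  have hlift := congrArg (PresentedMonoid.lift _ hrel) h
  change FreeMonoid.lift _ _ = FreeMonoid.lift _ _ at hlift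
  rw [FreeMonoid.lift_apply, FreeMonoid.lift_apply] at hlift
  rw [← prod_map_interleaveLetter_apply hc, ← prod_map_interleaveLetter_apply hc, ← h']
  exact congrFun (congrFun hlift (uValue u)) _

theorem prod_map_eval_eq_of_word_uIndex_eq (hu : RotationInvariant (s :: List.ofFn u))
    (hc : ∀ i j, Commute (t i) (u j)) {w w' : List (Letter m n)}
    (h : CycleRel.word (w.filterMap Letter.uIndex) = CycleRel.word (w'.filterMap Letter.uIndex))
    (h' : w.filterMap Letter.tIndex = w'.filterMap Letter.tIndex) :
    (w.map (Letter.eval s t u)).prod = (w'.map (Letter.eval s t u)).prod := by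
  rw [← Letter.map_eval_map_swap, ← Letter.map_eval_map_swap s t u w']
  refine prod_map_eval_eq_of_word_tIndex_eq hu (fun i j => (hc j i).symm) ?_ ?_
  · simpa only [Letter.filterMap_tIndex_map_swap] using h
  · simpa only [Letter.filterMap_uIndex_map_swap] using h'

end Interleaving

/-! ### Homomorphisms from the presented group -/

theorem ArrangementRel.lift_eval_eq {M : Type*} [Monoid M] {m n : ℕ} {s : M} {t : Fin m → M}
    {u : Fin n → M} (ht : RotationInvariant (s :: List.ofFn t))
    (hu : RotationInvariant (s :: List.ofFn u)) (hc : ∀ i j, Commute (t i) (u j))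
    (a b : FreeMonoid (Letter m n)) (h : ArrangementRel m n a b) :
    FreeMonoid.lift (Letter.eval s t u) a = FreeMonoid.lift (Letter.eval s t u) b := by
  cases h with
  | cyclic_t k =>
    simpa [FreeMonoid.lift_apply, List.map_rotate, List.map_ofFn, Function.comp_def, Letter.eval]
      using (ht k).symm
  | cyclic_u k =>
    simpa [FreeMonoid.lift_apply, List.map_rotate, List.map_ofFn, Function.comp_def, Letter.eval]
      using (hu k).symm
  | comm i j => simpa [Letter.eval] using (hc i j).eq

/-- The universal property of the presented group, on words: elements of a group that satisfy the
relations give equal values to words with the same image in the presented group. -/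
theorem prod_map_eval_eq_of_localizationHom_eq {H : Type*} [Group H] {m n : ℕ} {s : H}
    {t : Fin m → H} {u : Fin n → H} (ht : RotationInvariant (s :: List.ofFn t))
    (hu : RotationInvariant (s :: List.ofFn u)) (hc : ∀ i j, Commute (t i) (u j))
    {w w' : FreeMonoid (Letter m n)}
    (h : localizationHom (ArrangementRel m n) (PresentedMonoid.mk _ w) =
      localizationHom (ArrangementRel m n) (PresentedMonoid.mk _ w')) :
    (w.toList.map (Letter.eval s t u)).prod = (w'.toList.map (Letter.eval s t u)).prod := by
  have hcomp : ∀ a : FreeMonoid (Letter m n),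
      FreeGroup.lift (Letter.eval s t u) (FreeMonoid.lift FreeGroup.of a) =
        FreeMonoid.lift (Letter.eval s t u) a := by
    intro a
    induction a with
    | one => simp
    | of x => simp
    | mul x y hx hy => simp only [map_mul, hx, hy]
  have hrel : ∀ r ∈ {w : FreeGroup (Letter m n) | ∃ a b : FreeMonoid (Letter m n),
      ArrangementRel m n a b ∧
        w = FreeMonoid.lift FreeGroup.of a * (FreeMonoid.lift FreeGroup.of b)⁻¹},
      FreeGroup.lift (Letter.eval s t u) r = 1 := by
    rintro _ ⟨a, b, hab, rfl⟩
    rw [map_mul, map_inv, hcomp, hcomp, ArrangementRel.lift_eval_eq ht hu hc a b hab,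
      mul_inv_cancel]
  have hval : ∀ a : FreeMonoid (Letter m n),
      PresentedGroup.toGroup hrel (localizationHom _ (PresentedMonoid.mk _ a)) =
        (a.toList.map (Letter.eval s t u)).prod := by
    intro a
    rw [← FreeMonoid.lift_apply]
    induction a with
    | one => simp
    | of x => rw [FreeMonoid.lift_eval_of]; exact PresentedGroup.toGroup.of hrel
    | mul x y hx hy => simp only [map_mul, hx, hy]
  rw [← hval, ← hval, h]

theorem rotationInvariant_of_comm {M : Type*} [CommMonoid M] (l : List M) :
    RotationInvariant l := fun k => (List.rotate_perm l k).prod_eq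

theorem rotationInvariant_cons_ofFn_one {M : Type*} [Monoid M] (a : M) (n : ℕ) :
    RotationInvariant (a :: List.ofFn fun _ : Fin n => (1 : M)) := by
  intro k
  obtain ⟨c, d, hl, hr⟩ := List.exists_rotate_cons_eq a (List.ofFn fun _ : Fin n => (1 : M)) k
  have hone : ∀ x ∈ List.ofFn fun _ : Fin n => (1 : M), x = 1 := by simp
  rw [hl] at hone
  rw [hr, hl]
  simp [List.prod_eq_one fun x hx => hone x (List.mem_append_left _ hx),
    List.prod_eq_one fun x hx => hone x (List.mem_append_right _ hx)]

theorem rotationInvariant_pushPerm_cons (m : ℕ) :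
    RotationInvariant
      (pushPerm (0 : Fin (m + 1)) :: List.ofFn fun i : Fin m => pushPerm i.succ) := by
  have h := rotationInvariant_pushPerm m
  rw [List.finRange_succ] at h
  simpa [List.ofFn_eq_map, Function.comp_def] using h

/-- The projection to `s, tᵢ` is well defined on the group, and the monoid with the single cyclic
relation on `s, tᵢ` acts faithfully on reduced pairs by permutations. -/
theorem word_tIndex_eq_of_localizationHom_eq {m n : ℕ} {w w' : FreeMonoid (Letter m n)}
    (h : localizationHom (ArrangementRel m n) (PresentedMonoid.mk _ w) =
      localizationHom (ArrangementRel m n) (PresentedMonoid.mk _ w')) :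
    CycleRel.word (w.toList.filterMap Letter.tIndex) =
      CycleRel.word (w'.toList.filterMap Letter.tIndex) := by
  apply CycleRel.word_eq_of_prod_pushPerm_eq
  rw [← Letter.prod_map_eval_one, ← Letter.prod_map_eval_one]
  exact prod_map_eval_eq_of_localizationHom_eq (rotationInvariant_pushPerm_cons m)
    (rotationInvariant_cons_ofFn_one _ n) (fun _ _ => Commute.one_right _) h

theorem word_uIndex_eq_of_localizationHom_eq {m n : ℕ} {w w' : FreeMonoid (Letter m n)}
    (h : localizationHom (ArrangementRel m n) (PresentedMonoid.mk _ w) =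
      localizationHom (ArrangementRel m n) (PresentedMonoid.mk _ w')) :
    CycleRel.word (w.toList.filterMap Letter.uIndex) =
      CycleRel.word (w'.toList.filterMap Letter.uIndex) := by
  apply CycleRel.word_eq_of_prod_pushPerm_eq
  rw [← Letter.filterMap_tIndex_map_swap, ← Letter.filterMap_tIndex_map_swap,
    ← Letter.prod_map_eval_one, ← Letter.prod_map_eval_one, Letter.map_eval_map_swap,
    Letter.map_eval_map_swap]
  exact prod_map_eval_eq_of_localizationHom_eq (rotationInvariant_cons_ofFn_one _ m)
    (rotationInvariant_pushPerm_cons n) (fun _ _ => Commute.one_left _) h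

theorem prod_map_eval_ofAdd_eq_count_tIndex {m n : ℕ} (w : List (Letter m n)) :
    (w.map (Letter.eval (Multiplicative.ofAdd (1 : ℤ)) (fun _ => 1) fun _ => 1)).prod =
      Multiplicative.ofAdd ((w.filterMap Letter.tIndex).count 0 : ℤ) := by
  induction w with
  | nil => rfl
  | cons x w ih =>
    cases x <;> simp [Letter.eval, Letter.tIndex, ih, ofAdd_add, mul_comm]

theorem count_tIndex_eq_count_uIndex {m n : ℕ} (w : List (Letter m n)) :
    (w.filterMap Letter.tIndex).count 0 = (w.filterMap Letter.uIndex).count 0 := by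
  induction w with
  | nil => rfl
  | cons x w ih => cases x <;> simp [Letter.tIndex, Letter.uIndex, ih]

theorem proposition5p1 (m n : ℕ) :
    Function.Injective
      (localizationHom (ArrangementRel m n) : ArrangementMonoid m n →* ArrangementGroup m n) := by
  intro x y
  obtain ⟨w, rfl⟩ := PresentedMonoid.surjective_mk x
  obtain ⟨w', rfl⟩ := PresentedMonoid.surjective_mk y
  intro h
  let s : ArrangementMonoid m n := PresentedMonoid.of _ .s
  let t : Fin m → ArrangementMonoid m n := fun i => PresentedMonoid.of _ (.t i)
  let u : Fin n → ArrangementMonoid m n := fun j => PresentedMonoid.of _ (.u j)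
  have heval : (Letter.eval s t u) = PresentedMonoid.of (ArrangementRel m n) := by
    funext x; cases x <;> rfl
  have hmk : ∀ l : List (Letter m n), (l.map (Letter.eval s t u)).prod =
      PresentedMonoid.mk (ArrangementRel m n) (FreeMonoid.ofList l) := by
    intro l
    rw [heval]
    induction l with
    | nil => rfl
    | cons x l ih => rw [List.map_cons, List.prod_cons, ih]; rfl
  have ht : RotationInvariant (s :: List.ofFn t) := by
    intro k
    have := (PresentedMonoid.mk_eq_mk_of_rel (ArrangementRel.cyclic_t (m := m) (n := n) k)).symm
    rw [← hmk, ← hmk] at this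
    simpa [List.map_rotate, List.map_ofFn, Function.comp_def, Letter.eval] using this
  have hu : RotationInvariant (s :: List.ofFn u) := by
    intro k
    have := (PresentedMonoid.mk_eq_mk_of_rel (ArrangementRel.cyclic_u (m := m) (n := n) k)).symm
    rw [← hmk, ← hmk] at this
    simpa [List.map_rotate, List.map_ofFn, Function.comp_def, Letter.eval] using this
  have hc : ∀ i j, Commute (t i) (u j) := fun i j =>
    PresentedMonoid.mk_eq_mk_of_rel (ArrangementRel.comm i j)
  have hcount : (w'.toList.filterMap Letter.tIndex).count 0 =
      (w.toList.filterMap Letter.uIndex).count 0 := by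
    have := prod_map_eval_eq_of_localizationHom_eq
      (s := Multiplicative.ofAdd (1 : ℤ)) (t := fun _ => 1) (u := fun _ => 1)
      (rotationInvariant_of_comm _) (rotationInvariant_of_comm _) (fun _ _ => Commute.all _ _) h
    rw [prod_map_eval_ofAdd_eq_count_tIndex, prod_map_eval_ofAdd_eq_count_tIndex] at this
    rw [← count_tIndex_eq_count_uIndex]
    exact_mod_cast (Multiplicative.ofAdd.injective this).symm
  -- The projection to `s, tᵢ` is changed first, then the projection to `s, uⱼ`.
  obtain ⟨v, hv₁, hv₂⟩ := Letter.exists_filterMap_eq _ _ hcount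
  calc PresentedMonoid.mk (ArrangementRel m n) w
      = (w.toList.map (Letter.eval s t u)).prod := (hmk w.toList).symm
    _ = (v.map (Letter.eval s t u)).prod := prod_map_eval_eq_of_word_tIndex_eq ht hc
        (by rw [hv₁]; exact word_tIndex_eq_of_localizationHom_eq h) hv₂.symm
    _ = (w'.toList.map (Letter.eval s t u)).prod := prod_map_eval_eq_of_word_uIndex_eq hu hc
        (by rw [hv₂]; exact word_uIndex_eq_of_localizationHom_eq h) hv₁
    _ = PresentedMonoid.mk (ArrangementRel m n) w' := hmk w'.toList
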